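/- For $s\in\mathbb R$ let $h_s(n)=n^s$ ($n\ge 1$), let $P_0^{h_s}(x)=1$ and $P_n^{h_s}(x)=\frac{x}{h_s(n)}\sum_{k=0}^{n-1}P_k^{h_s}(x)$ for $n\ge 1$, and write $P_n^{h_s}(x)=\sum_{k=0}^n A_{n,k}(s)\,x^k$ (with $A_{n,k}(s)=0$ for $k>n$). Put $$\mu_n(s)=1+\sum_{k=1}^{n-1}\frac1{1+k^s},\qquad \sigma_n(s)=\Big(\sum_{k=1}^{n-1}\frac{k^s}{(1+k^s)^2}\Big)^{1/2},\qquad x_n(s)=\frac{k-\mu_n(s)}{\sigma_n(s)}.$$ There exists a universal constant $K>0$ such that for all $s\in\mathbb R$ and all $n\ge 2$ (so that $\sigma_n(s)>0$) $$\max_{k\ge 0}\left|\frac{\sigma_n(s)}{P_n^{h_s}(1)}A_{n,k}(s)-\frac{e^{-x_n(s)^2/2}}{\sqrt{2\pi}}\right|<\frac{K}{\sigma_n(s)}.$$ Moreover, uniformly for $k-\mu_n(s)=O(\sigma_n(s))$, $$\frac{A_{n,k}(s)}{P_n^{h_s}(1)}\sim\frac{e^{-x_n(s)^2/2}}{\sigma_n(s)\sqrt{2\pi}}\qquad\text{as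 }\sigma_n(s)\to\infty;$$ that is, for all $C,\varepsilon>0$ there is $S>0$ such that for all $s\in\mathbb R$, all $n$ with $\sigma_n(s)\ge S$ and all integers $k\ge 0$ with $|k-\mu_n(s)|\le C\sigma_n(s)$, the quotient of the two sides differs from $1$ by less than $\varepsilon$. In particular, for each fixed $s\in[-1,1]$ one has $\sigma_n(s)\to\infty$ as $n\to\infty$, and the asymptotic formula holds as $n\to\infty$: for all $C,\varepsilon>0$ there is $N$ such that for all $n\ge N$ and all integers $k\ge 0$ with $|k-\mu_n(s)|\le C\sigma_n(s)$, the quotient of the two sides differs from $1$ by less than $\varepsilon$. -/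

import Mathlib

open Filter Topology

/-- The arithmetic function `h_s(n) = n ^ s` (only its values at `n ≥ 1` are ever used). -/
noncomputable def hPow (s : ℝ) (n : ℕ) : ℝ := (n : ℝ) ^ s

/-- The polynomials `P_n^h(x)`: `P_0^h = 1` and
`P_n^h(x) = (x / h(n)) * ∑_{k=0}^{n-1} P_k^h(x)` for `n ≥ 1`. -/
noncomputable def polyP (h : ℕ → ℝ) : ℕ → Polynomial ℝ
  | 0 => 1
  | n + 1 => Polynomial.C (1 / h (n + 1)) * Polynomial.X * ∑ k : Fin (n + 1), polyP h k.val
decreasing_by exact k.isLt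

theorem polyP_zero (h : ℕ → ℝ) : polyP h 0 = 1 := by
  rw [polyP]

theorem polyP_succ (h : ℕ → ℝ) (n : ℕ) :
    polyP h (n + 1) =
      Polynomial.C (1 / h (n + 1)) * Polynomial.X * ∑ k ∈ Finset.range (n + 1), polyP h k := by
  rw [polyP, Finset.sum_range]

/-- The coefficients `A_{n,k}(s)` of `P_n^{h_s}(x) = ∑_{k=0}^n A_{n,k}(s) x^k`. -/
noncomputable def coeffA (s : ℝ) (n k : ℕ) : ℝ := (polyP (hPow s) n).coeff k

/-- The value `P_n^{h_s}(1)`. -/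
noncomputable def totalP (s : ℝ) (n : ℕ) : ℝ := (polyP (hPow s) n).eval 1

/-- `μ_n(s) = 1 + ∑_{k=1}^{n-1} 1 / (1 + k^s)`. -/
noncomputable def meanMu (s : ℝ) (n : ℕ) : ℝ :=
  1 + ∑ k ∈ Finset.Ico 1 n, 1 / (1 + (k : ℝ) ^ s)

/-- `σ_n(s)`, the nonnegative square root of `∑_{k=1}^{n-1} k^s / (1 + k^s)^2`. -/
noncomputable def stdSigma (s : ℝ) (n : ℕ) : ℝ :=
  Real.sqrt (∑ k ∈ Finset.Ico 1 n, (k : ℝ) ^ s / (1 + (k : ℝ) ^ s) ^ 2)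

/-- `x_n(s) = (k - μ_n(s)) / σ_n(s)`. -/
noncomputable def normX (s : ℝ) (n k : ℕ) : ℝ := ((k : ℝ) - meanMu s n) / stdSigma s n

/-- The Gaussian approximation `exp (- x_n(s)^2 / 2) / (σ_n(s) √(2π))`. -/
noncomputable def gaussApprox (s : ℝ) (n k : ℕ) : ℝ :=
  Real.exp (-(normX s n k) ^ 2 / 2) / (stdSigma s n * Real.sqrt (2 * Real.pi))

/-! The partial sums of the recursion gain a factor `1 + x / h(k)` at each step, so `P_n` is `x /
h(n)` times a product of such factors. Hence `P_n(x) / P_n(1)` is the generating function of `1`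
plus independent Bernoulli variables with parameters `1 / (1 + k^s)`, of mean `μ_n` and variance `v
= σ_n²`, and the claim is a local limit theorem with rate.

Fourier inversion writes each coefficient as an integral over `[-π, π]`. Each centred Bernoulli
factor differs from its Gaussian counterpart by `O(p(1-p)|t|³)`, and both are at most
`exp(-2p(1-p)t²/π²)`. By `norm_prod_sub_prod_le` the products differ by `O(v|t|³ exp(-2vt²/π²))`,
which integrates to `O(1/v)`; multiplying by `σ_n` leaves `O(1/σ_n)`. For the quotient form, the
Gaussian is bounded below on `|x| ≤ C`. -/

/-! ### Factorisation into Bernoulli generating functions -/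

theorem sum_polyP (h : ℕ → ℝ) (n : ℕ) :
    ∑ k ∈ Finset.range (n + 1), polyP h k =
      ∏ k ∈ Finset.Ico 1 (n + 1), (1 + Polynomial.C (1 / h k) * Polynomial.X) := by
  induction n with
  | zero => simp [polyP_zero]
  | succ n ih =>
    rw [Finset.sum_range_succ, polyP_succ, Finset.prod_Ico_succ_top (by omega), ← ih]
    ring

theorem polyP_eq_prod (h : ℕ → ℝ) {n : ℕ} (hn : 1 ≤ n) :
    polyP h n = Polynomial.C (1 / h n) * Polynomial.X *
      ∏ k ∈ Finset.Ico 1 n, (1 + Polynomial.C (1 / h k) * Polynomial.X) := by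
  obtain ⟨m, rfl⟩ := Nat.exists_eq_add_of_le' hn
  rw [polyP_succ, sum_polyP]

theorem polyP_hPow_eq (s : ℝ) {n : ℕ} (hn : 1 ≤ n) :
    polyP (hPow s) n = Polynomial.C (totalP s n) * (Polynomial.X *
      ∏ k ∈ Finset.Ico 1 n, (Polynomial.C (1 - 1 / (1 + (k : ℝ) ^ s)) +
        Polynomial.C (1 / (1 + (k : ℝ) ^ s)) * Polynomial.X)) := by
  have key : ∏ k ∈ Finset.Ico 1 n, (1 + Polynomial.C (1 / hPow s k) * Polynomial.X) =
      Polynomial.C (∏ k ∈ Finset.Ico 1 n, (1 + 1 / hPow s k)) *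
      ∏ k ∈ Finset.Ico 1 n, (Polynomial.C (1 - 1 / (1 + (k : ℝ) ^ s)) +
        Polynomial.C (1 / (1 + (k : ℝ) ^ s)) * Polynomial.X) := by
    rw [map_prod, ← Finset.prod_mul_distrib]
    refine Finset.prod_congr rfl fun k hk => ?_
    have hk1 : 1 ≤ k := (Finset.mem_Ico.mp hk).1
    have hpos : 0 < (k : ℝ) ^ s := Real.rpow_pos_of_pos (by exact_mod_cast hk1) s
    have e1 : (1 + 1 / (k : ℝ) ^ s) * (1 - 1 / (1 + (k : ℝ) ^ s)) = 1 := by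
      field_simp
      ring
    have e2 : (1 + 1 / (k : ℝ) ^ s) * (1 / (1 + (k : ℝ) ^ s)) = 1 / (k : ℝ) ^ s := by
      field_simp
      ring
    rw [mul_add, ← mul_assoc, ← Polynomial.C_mul, ← Polynomial.C_mul, hPow, e1, e2,
      Polynomial.C_1]
  have ht : totalP s n = 1 / hPow s n * ∏ k ∈ Finset.Ico 1 n, (1 + 1 / hPow s k) := by
    rw [totalP, polyP_eq_prod _ hn]
    simp [Polynomial.eval_prod]
  rw [polyP_eq_prod _ hn, key, ht, Polynomial.C_mul]
  ring

theorem totalP_pos (s : ℝ) {n : ℕ} (hn : 1 ≤ n) : 0 < totalP s n := by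
  have hp : ∀ k : ℕ, 1 ≤ k → 0 < hPow s k := fun k hk =>
    Real.rpow_pos_of_pos (by exact_mod_cast hk) s
  rw [totalP, polyP_eq_prod _ hn]
  simp only [Polynomial.eval_mul, Polynomial.eval_C, Polynomial.eval_X, Polynomial.eval_prod,
    Polynomial.eval_add, Polynomial.eval_one, mul_one]
  have := hp n hn
  refine mul_pos (by positivity) (Finset.prod_pos fun k hk => ?_)
  have := hp k (Finset.mem_Ico.mp hk).1
  positivity

theorem coeffA_eq_totalP_mul (s : ℝ) {n : ℕ} (hn : 1 ≤ n) (k : ℕ) :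
    coeffA s n k = totalP s n * (Polynomial.X *
      ∏ k ∈ Finset.Ico 1 n, (Polynomial.C (1 - 1 / (1 + (k : ℝ) ^ s)) +
        Polynomial.C (1 / (1 + (k : ℝ) ^ s)) * Polynomial.X)).coeff k := by
  rw [coeffA, polyP_hPow_eq s hn, Polynomial.coeff_C_mul]

/-! ### Fourier inversion on the circle -/

theorem integral_exp_int_mul_I (m : ℤ) :
    ∫ t in (-Real.pi)..Real.pi, Complex.exp (m * t * Complex.I) =
      if m = 0 then 2 * (Real.pi : ℂ) else 0 := by
  split_ifs with h
  · simp [h]; ring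
  · have hc : (m * Complex.I : ℂ) ≠ 0 := by simp [h]
    have : ∀ t : ℝ, Complex.exp (m * t * Complex.I) = Complex.exp (m * Complex.I * t) := by
      intro t; congr 1; ring
    simp_rw [this]
    rw [integral_exp_mul_complex hc]
    have e : (m * Complex.I * (Real.pi : ℝ) : ℂ) =
        m * Complex.I * ((-Real.pi : ℝ) : ℂ) + m * (2 * Real.pi * Complex.I) := by
      push_cast; ring
    rw [e, Complex.exp_add, Complex.exp_int_mul_two_pi_mul_I]
    simp

/-- Fourier inversion for a polynomial on the unit circle. -/
theorem Polynomial.integral_eval_exp_mul_I (p : Polynomial ℂ) (k : ℕ) :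
    ∫ t in (-Real.pi)..Real.pi,
      p.eval (Complex.exp (t * Complex.I)) * Complex.exp (-(k * t * Complex.I)) =
      2 * Real.pi * p.coeff k := by
  have : ∀ t : ℝ, p.eval (Complex.exp (t * Complex.I)) * Complex.exp (-(k * t * Complex.I)) =
      ∑ m ∈ p.support, p.coeff m * Complex.exp (((m - k : ℤ) : ℂ) * t * Complex.I) := by
    intro t
    rw [Polynomial.eval_eq_sum, Polynomial.sum, Finset.sum_mul]
    refine Finset.sum_congr rfl fun m _ => ?_
    rw [mul_assoc, ← Complex.exp_nat_mul, ← Complex.exp_add]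
    congr 2
    push_cast
    ring
  simp_rw [this]
  rw [intervalIntegral.integral_finsetSum]
  · simp_rw [intervalIntegral.integral_const_mul, integral_exp_int_mul_I]
    rw [Finset.sum_eq_single k]
    · simp; ring
    · intro m _ hm
      have : ((m : ℤ) - k) ≠ 0 := by omega
      simp [this]
    · intro hk
      simp [Polynomial.notMem_support_iff.mp hk]
  · intro m _
    exact Continuous.intervalIntegrable (by fun_prop) _ _

/-! ### Comparison of characteristic functions -/

/-- Factors are swapped one at a time. Measuring each error relative to `c i` keeps the full product
of the `c i`, hence all the Gaussian decay, in the bound. -/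
theorem norm_prod_sub_prod_le {ι : Type*} (S : Finset ι) (a b : ι → ℂ) (c d : ι → ℝ)
    (ha : ∀ i ∈ S, ‖a i‖ ≤ c i) (hb : ∀ i ∈ S, ‖b i‖ ≤ c i) (hd : ∀ i ∈ S, 0 ≤ d i)
    (hab : ∀ i ∈ S, ‖a i - b i‖ ≤ d i * c i) :
    ‖∏ i ∈ S, a i - ∏ i ∈ S, b i‖ ≤ (∑ i ∈ S, d i) * ∏ i ∈ S, c i := by
  classical
  induction S using Finset.induction_on with
  | empty => simp
  | insert j S hj ih =>
    simp only [Finset.forall_mem_insert] at ha hb hd hab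
    rw [Finset.prod_insert hj, Finset.prod_insert hj, Finset.prod_insert hj, Finset.sum_insert hj]
    have h1 : ‖∏ i ∈ S, a i‖ ≤ ∏ i ∈ S, c i := by
      rw [norm_prod]
      exact Finset.prod_le_prod (fun i _ => norm_nonneg _) ha.2
    have h2 := ih ha.2 hb.2 hd.2 hab.2
    have hc : 0 ≤ c j := (norm_nonneg _).trans ha.1
    calc ‖a j * ∏ i ∈ S, a i - b j * ∏ i ∈ S, b i‖
        = ‖(a j - b j) * ∏ i ∈ S, a i + b j * (∏ i ∈ S, a i - ∏ i ∈ S, b i)‖ := by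
          congr 1; ring
      _ ≤ ‖a j - b j‖ * ‖∏ i ∈ S, a i‖ + ‖b j‖ * ‖∏ i ∈ S, a i - ∏ i ∈ S, b i‖ := by
          refine (norm_add_le _ _).trans ?_
          rw [norm_mul, norm_mul]
      _ ≤ d j * c j * ∏ i ∈ S, c i + c j * ((∑ i ∈ S, d i) * ∏ i ∈ S, c i) := by
          have := mul_nonneg hd.1 hc
          gcongr
          · exact hab.1
          · exact hb.1
      _ = _ := by ring

/-- The characteristic function of a centred Bernoulli variable. -/
noncomputable def bernoulliChar (p t : ℝ) : ℂ :=
  Complex.exp (-(p * t * Complex.I)) * (((1 - p : ℝ) : ℂ) + (p : ℂ) * Complex.exp (t * Complex.I))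

/-- The squared norm is `1 - 2p(1-p)(1 - cos t)`; then `cos t ≤ 1 - 2t²/π²` and `1 + x ≤ exp x`. -/
theorem norm_bernoulliChar_le {p t : ℝ} (hp0 : 0 ≤ p) (hp1 : p ≤ 1) (ht : |t| ≤ Real.pi) :
    ‖bernoulliChar p t‖ ≤ Real.exp (-(2 * (p * (1 - p)) * t ^ 2 / Real.pi ^ 2)) := by
  have e1 : ‖Complex.exp (-(p * t * Complex.I))‖ = 1 := by
    have : (-(p * t * Complex.I) : ℂ) = ((-(p * t) : ℝ) : ℂ) * Complex.I := by push_cast; ring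
    rw [this, Complex.norm_exp_ofReal_mul_I]
  have e2 : ‖bernoulliChar p t‖ ^ 2 = 1 - 2 * (p * (1 - p)) * (1 - Real.cos t) := by
    rw [bernoulliChar, norm_mul, e1, one_mul, Complex.sq_norm, Complex.normSq_apply]
    simp only [Complex.add_re, Complex.add_im, Complex.ofReal_re, Complex.ofReal_im,
      Complex.re_ofReal_mul, Complex.im_ofReal_mul, Complex.exp_ofReal_mul_I_re,
      Complex.exp_ofReal_mul_I_im]
    linear_combination p ^ 2 * Real.sin_sq_add_cos_sq t
  have hcos := Real.cos_le_one_sub_mul_cos_sq ht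
  have hpq : 0 ≤ p * (1 - p) := mul_nonneg hp0 (by linarith)
  refine (sq_le_sq₀ (norm_nonneg _) (Real.exp_pos _).le).mp ?_
  rw [e2, ← Real.exp_nat_mul]
  have h3 := Real.add_one_le_exp (((2 : ℕ) : ℝ) * -(2 * (p * (1 - p)) * t ^ 2 / Real.pi ^ 2))
  refine le_trans ?_ h3
  have := mul_le_mul_of_nonneg_left hcos hpq
  have e3 : ((2 : ℕ) : ℝ) * -(2 * (p * (1 - p)) * t ^ 2 / Real.pi ^ 2) =
    -2 * (p * (1 - p) * (2 / Real.pi ^ 2 * t ^ 2)) := by push_cast; ring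
  rw [e3]
  nlinarith

theorem norm_exp_mul_I_sub_le {x : ℝ} (hx : |x| ≤ Real.pi) :
    ‖Complex.exp (x * Complex.I) - (1 + x * Complex.I - x ^ 2 / 2)‖ ≤
      Real.exp Real.pi * |x| ^ 3 := by
  have h := Complex.norm_exp_sub_sum_le_norm_mul_exp (x * Complex.I) 3
  have hn : ‖(x * Complex.I : ℂ)‖ = |x| := by simp
  rw [hn] at h
  have e : ∑ m ∈ Finset.range 3, (x * Complex.I : ℂ) ^ m / (m.factorial : ℂ) =
      1 + x * Complex.I - x ^ 2 / 2 := by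
    simp [Finset.sum_range_succ, mul_pow, Nat.factorial]
    ring
  rw [e] at h
  refine h.trans ?_
  rw [mul_comm]
  gcongr

theorem abs_exp_neg_sub_le {y : ℝ} (hy0 : 0 ≤ y) (hy : y ≤ Real.pi) :
    |Real.exp (-y) - (1 - y)| ≤ Real.exp Real.pi * y ^ 2 := by
  have h := Complex.norm_exp_sub_sum_le_norm_mul_exp ((-y : ℝ) : ℂ) 2
  have hn : ‖((-y : ℝ) : ℂ)‖ = y := by rw [Complex.norm_real, Real.norm_eq_abs, abs_neg, abs_of_nonneg hy0]
  rw [hn] at h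
  have e : Complex.exp ((-y : ℝ) : ℂ) - ∑ m ∈ Finset.range 2, ((-y : ℝ) : ℂ) ^ m / (m.factorial : ℂ) =
      ((Real.exp (-y) - (1 - y) : ℝ) : ℂ) := by
    simp [Finset.sum_range_succ, Nat.factorial]
    ring
  rw [e, Complex.norm_real, Real.norm_eq_abs] at h
  refine h.trans ?_
  rw [mul_comm]
  gcongr

/-- With `q = 1 - p`, expand `q exp(-ipt) + p exp(iqt)` to second order: the linear terms cancel and
the quadratic ones give `-pqt²/2`. The cubic remainders carry the weight `qp³ + pq³ = pq(1 - 2pq)`,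
which retains the factor `pq`. -/
theorem norm_bernoulliChar_sub_exp_le {p t : ℝ} (hp0 : 0 ≤ p) (hp1 : p ≤ 1)
    (ht : |t| ≤ Real.pi) :
    ‖bernoulliChar p t - (Real.exp (-(p * (1 - p) * t ^ 2 / 2)) : ℂ)‖ ≤
      2 * Real.exp Real.pi * (p * (1 - p)) * |t| ^ 3 := by
  have hq0 : 0 ≤ 1 - p := by linarith
  have hpq : 0 ≤ p * (1 - p) := mul_nonneg hp0 hq0
  have hpq4 : p * (1 - p) ≤ 1 / 4 := by nlinarith [sq_nonneg (2 * p - 1)]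
  have hE := Real.exp_pos Real.pi
  have hpi := Real.pi_pos
  have hpi4 := Real.pi_le_four
  have ht2 : t ^ 2 ≤ Real.pi * |t| := by
    rw [← sq_abs, sq]; gcongr
  have ht0 := abs_nonneg t
  set y := p * (1 - p) * t ^ 2 / 2 with hy
  have hy0 : 0 ≤ y := by positivity
  have hyle : y ≤ |t| / 2 := by
    have : p * (1 - p) * t ^ 2 ≤ 1 / 4 * (Real.pi * |t|) := by gcongr
    nlinarith
  have hA := norm_exp_mul_I_sub_le (x := -(p * t)) (by
    rw [abs_neg, abs_mul, abs_of_nonneg hp0]; nlinarith)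
  have hB := norm_exp_mul_I_sub_le (x := (1 - p) * t) (by
    rw [abs_mul, abs_of_nonneg hq0]; nlinarith)
  have hC := abs_exp_neg_sub_le hy0 (by linarith)
  have hC' : ‖((Real.exp (-y) - (1 - y) : ℝ) : ℂ)‖ ≤ Real.exp Real.pi * y ^ 2 := by
    rwa [Complex.norm_real, Real.norm_eq_abs]
  rw [abs_neg, abs_mul, abs_of_nonneg hp0] at hA
  rw [abs_mul, abs_of_nonneg hq0] at hB
  have e : bernoulliChar p t - (Real.exp (-y) : ℂ) =
      ((1 - p : ℝ) : ℂ) * (Complex.exp ((-(p * t) : ℝ) * Complex.I) -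
        (1 + (-(p * t) : ℝ) * Complex.I - ((-(p * t) : ℝ) : ℂ) ^ 2 / 2)) +
      (p : ℂ) * (Complex.exp (((1 - p) * t : ℝ) * Complex.I) -
        (1 + ((1 - p) * t : ℝ) * Complex.I - (((1 - p) * t : ℝ) : ℂ) ^ 2 / 2)) -
      ((Real.exp (-y) - (1 - y) : ℝ) : ℂ) := by
    have e1 : Complex.exp (((1 - p) * t : ℝ) * Complex.I) =
        Complex.exp (-(p * t * Complex.I)) * Complex.exp (t * Complex.I) := by
      rw [← Complex.exp_add]; congr 1; push_cast; ring
    have e2 : Complex.exp ((-(p * t) : ℝ) * Complex.I) = Complex.exp (-(p * t * Complex.I)) := by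
      congr 1; push_cast; ring
    rw [e1, e2, bernoulliChar, hy]
    push_cast
    ring
  rw [e]
  refine (norm_sub_le _ _).trans ((add_le_add (norm_add_le _ _) hC').trans ?_)
  rw [norm_mul, norm_mul, Complex.norm_real, Complex.norm_real, Real.norm_of_nonneg hp0,
    Real.norm_of_nonneg hq0]
  have h1 := mul_le_mul_of_nonneg_left hA hq0
  have h2 := mul_le_mul_of_nonneg_left hB hp0
  have h3 : y ^ 2 ≤ p * (1 - p) * |t| ^ 3 := by
    have : y ^ 2 ≤ y * (|t| / 2) := by rw [sq]; gcongr
    have h4 : y * (|t| / 2) = p * (1 - p) * |t| ^ 3 / 4 := by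
      rw [hy, ← sq_abs t]; ring
    have : 0 ≤ p * (1 - p) * |t| ^ 3 := by positivity
    linarith
  have h4 := mul_le_mul_of_nonneg_left h3 hE.le
  have h5 : (1 - p) * (Real.exp Real.pi * (p * |t|) ^ 3) +
      p * (Real.exp Real.pi * ((1 - p) * |t|) ^ 3) ≤ Real.exp Real.pi * (p * (1 - p)) * |t| ^ 3 := by
    have e5 : (1 - p) * (Real.exp Real.pi * (p * |t|) ^ 3) +
      p * (Real.exp Real.pi * ((1 - p) * |t|) ^ 3) =
      (Real.exp Real.pi * (p * (1 - p)) * |t| ^ 3) * (1 - 2 * (p * (1 - p))) := by ring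
    rw [e5]
    exact mul_le_of_le_one_right (by positivity) (by linarith)
  linarith

/-- The characteristic function of a centred sum of independent Bernoulli variables is close to
that of the Gaussian of the same variance. -/
theorem norm_prod_bernoulliChar_sub_exp_le {ι : Type*} (S : Finset ι) (p : ι → ℝ)
    (hp0 : ∀ i ∈ S, 0 ≤ p i) (hp1 : ∀ i ∈ S, p i ≤ 1) {t : ℝ} (ht : |t| ≤ Real.pi) :
    ‖∏ i ∈ S, bernoulliChar (p i) t -
        (Real.exp (-((∑ i ∈ S, p i * (1 - p i)) * t ^ 2 / 2)) : ℂ)‖ ≤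
      2 * Real.exp Real.pi * Real.exp (1 / 2) * (∑ i ∈ S, p i * (1 - p i)) * |t| ^ 3 *
        Real.exp (-(2 / Real.pi ^ 2 * (∑ i ∈ S, p i * (1 - p i)) * t ^ 2)) := by
  have hpi := Real.pi_pos
  have hpi3 := Real.pi_gt_three
  have hpq : ∀ i ∈ S, 0 ≤ p i * (1 - p i) := fun i hi =>
    mul_nonneg (hp0 i hi) (by linarith [hp1 i hi])
  have hpq4 : ∀ i ∈ S, p i * (1 - p i) ≤ 1 / 4 := fun i hi => by
    nlinarith [sq_nonneg (2 * p i - 1)]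
  have ht2 : t ^ 2 ≤ Real.pi ^ 2 := sq_le_sq' (by linarith [neg_abs_le t]) (by linarith [le_abs_self t])
  have h := norm_prod_sub_prod_le S (fun i => bernoulliChar (p i) t)
    (fun i => (Real.exp (-(p i * (1 - p i) * t ^ 2 / 2)) : ℂ))
    (fun i => Real.exp (-(2 * (p i * (1 - p i)) * t ^ 2 / Real.pi ^ 2)))
    (fun i => 2 * Real.exp Real.pi * Real.exp (1 / 2) * (p i * (1 - p i)) * |t| ^ 3)
    (fun i hi => norm_bernoulliChar_le (hp0 i hi) (hp1 i hi) ht)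
    (fun i hi => by
      rw [Complex.norm_real, Real.norm_of_nonneg (Real.exp_pos _).le]
      refine Real.exp_le_exp.mpr (neg_le_neg ?_)
      have := mul_nonneg (hpq i hi) (sq_nonneg t)
      rw [div_le_div_iff₀ (by positivity) (by positivity)]
      have hpi4 : 4 ≤ Real.pi ^ 2 := by nlinarith
      have := mul_le_mul_of_nonneg_left hpi4 this
      linarith)
    (fun i hi => by have := hpq i hi; positivity)
    (fun i hi => by
      refine (norm_bernoulliChar_sub_exp_le (hp0 i hi) (hp1 i hi) ht).trans ?_
      have h0 := hpq i hi
      -- The factor `exp(1/2)` turns the absolute error into a relative one: the exponent is at most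
      -- `1/2` in size, as `p(1-p) ≤ 1/4` and `t² ≤ π²`.
      have : 1 ≤ Real.exp (1 / 2) *
          Real.exp (-(2 * (p i * (1 - p i)) * t ^ 2 / Real.pi ^ 2)) := by
        rw [← Real.exp_add]
        refine Real.one_le_exp ?_
        have h1 : 2 * (p i * (1 - p i)) * t ^ 2 / Real.pi ^ 2 ≤ 1 / 2 := by
          rw [div_le_iff₀ (by positivity)]
          have := mul_le_mul (hpq4 i hi) ht2 (sq_nonneg t) (by norm_num)
          linarith
        linarith
      have h2 := mul_le_mul_of_nonneg_left this
        (show 0 ≤ 2 * Real.exp Real.pi * (p i * (1 - p i)) * |t| ^ 3 by positivity)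
      linarith)
  have e1 : ∏ i ∈ S, (Real.exp (-(p i * (1 - p i) * t ^ 2 / 2)) : ℂ) =
      (Real.exp (-((∑ i ∈ S, p i * (1 - p i)) * t ^ 2 / 2)) : ℂ) := by
    rw [← Complex.ofReal_prod, ← Real.exp_sum, Finset.sum_neg_distrib, Finset.sum_mul,
      Finset.sum_div]
  have e2 : ∏ i ∈ S, Real.exp (-(2 * (p i * (1 - p i)) * t ^ 2 / Real.pi ^ 2)) =
      Real.exp (-(2 / Real.pi ^ 2 * (∑ i ∈ S, p i * (1 - p i)) * t ^ 2)) := by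
    rw [← Real.exp_sum, Finset.sum_neg_distrib, Finset.mul_sum, Finset.sum_mul]
    congr 2
    exact Finset.sum_congr rfl fun i _ => by ring
  rw [e1, e2, ← Finset.sum_mul, ← Finset.mul_sum] at h
  exact h

/-! ### Gaussian integrals and the local limit theorem -/

open MeasureTheory in
theorem integrable_abs_pow_three_mul_exp {b : ℝ} (hb : 0 < b) :
    Integrable fun t : ℝ => |t| ^ 3 * Real.exp (-(b * t ^ 2)) := by
  have h := (integrable_rpow_mul_exp_neg_mul_sq hb (s := 3) (by norm_num)).norm
  refine h.congr (ae_of_all _ fun t => ?_)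
  have : t ^ (3 : ℝ) = t ^ 3 := by exact_mod_cast Real.rpow_natCast t 3
  simp only [this, norm_mul, norm_pow, Real.norm_eq_abs, Real.abs_exp, neg_mul]

theorem integral_abs_pow_three_mul_exp {b v : ℝ} (hv : 0 < v) :
    ∫ t : ℝ, |t| ^ 3 * Real.exp (-(b * v * t ^ 2)) =
      (v ^ 2)⁻¹ * ∫ t : ℝ, |t| ^ 3 * Real.exp (-(b * t ^ 2)) := by
  have hs := Real.sqrt_pos.mpr hv
  have hsq := Real.sq_sqrt hv.le
  have h := MeasureTheory.Measure.integral_comp_mul_left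
    (fun t : ℝ => |t| ^ 3 * Real.exp (-(b * t ^ 2))) (Real.sqrt v)
  have e : ∀ t : ℝ, |Real.sqrt v * t| ^ 3 * Real.exp (-(b * (Real.sqrt v * t) ^ 2)) =
      Real.sqrt v ^ 3 * (|t| ^ 3 * Real.exp (-(b * v * t ^ 2))) := by
    intro t
    rw [abs_mul, abs_of_pos hs, mul_pow, mul_pow, hsq]
    ring_nf
  simp_rw [e, MeasureTheory.integral_const_mul] at h
  rw [abs_of_pos (inv_pos.mpr hs), smul_eq_mul] at h
  have h4 : v ^ 2 = Real.sqrt v * Real.sqrt v ^ 3 := by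
    rw [← hsq]; ring_nf; rw [Real.sqrt_sq hs.le]
  rw [h4, mul_inv, mul_assoc, mul_left_comm, ← h, inv_mul_cancel_left₀ (by positivity)]

theorem integral_exp_mul_gaussian {v : ℝ} (hv : 0 < v) (y : ℝ) :
    ∫ t : ℝ, Complex.exp (-(y * t * Complex.I)) * (Real.exp (-(v * t ^ 2 / 2)) : ℂ) =
      ((Real.sqrt (2 * Real.pi) / Real.sqrt v * Real.exp (-(y / Real.sqrt v) ^ 2 / 2) : ℝ) : ℂ) := by
  have hb : 0 < ((v / 2 : ℝ) : ℂ).re := by simpa using hv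
  have h := fourierIntegral_gaussian hb ((-y : ℝ) : ℂ)
  have e : ∀ t : ℝ, Complex.exp (-(y * t * Complex.I)) * (Real.exp (-(v * t ^ 2 / 2)) : ℂ) =
      Complex.exp (Complex.I * ((-y : ℝ) : ℂ) * t) *
        Complex.exp (-((v / 2 : ℝ) : ℂ) * (t : ℂ) ^ 2) := by
    intro t
    push_cast
    congr 2 <;> ring
  simp_rw [e]
  rw [h]
  have hpi := Real.pi_pos
  have e1 : ((Real.pi : ℂ) / ((v / 2 : ℝ) : ℂ)) ^ (1 / 2 : ℂ) =
      ((Real.sqrt (2 * Real.pi) / Real.sqrt v : ℝ) : ℂ) := by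
    rw [← Real.sqrt_div (by positivity), Real.sqrt_eq_rpow, Complex.ofReal_cpow (by positivity)]
    push_cast
    congr 1
    field_simp
  rw [e1, Complex.ofReal_mul, Complex.ofReal_exp, div_pow, Real.sq_sqrt hv.le]
  congr 2
  push_cast
  have : (v : ℂ) ≠ 0 := by exact_mod_cast hv.ne'
  field_simp
  ring

/-- The constant in the local limit theorem for sums of independent Bernoulli variables. -/
noncomputable def localLimitConst : ℝ :=
  2 * Real.exp Real.pi * Real.exp (1 / 2) *
    ∫ t : ℝ, |t| ^ 3 * Real.exp (-(2 / Real.pi ^ 2 * t ^ 2))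

theorem localLimitConst_nonneg : 0 ≤ localLimitConst :=
  mul_nonneg (by positivity) (MeasureTheory.integral_nonneg fun t => by positivity)

-- One majorant on all of `ℝ` serves both the error on `[-π, π]` and the Gaussian tail outside:
-- there `|t| ≥ 3` and `v ≥ 1/4` make its prefactor at least `1`.
open MeasureTheory in
theorem norm_integral_sub_integral_gaussian_le {f : ℝ → ℂ} {v y : ℝ} (hf : Continuous f)
    (hv : 1 / 4 ≤ v)
    (hfv : ∀ t : ℝ, |t| ≤ Real.pi → ‖f t - (Real.exp (-(v * t ^ 2 / 2)) : ℂ)‖ ≤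
      2 * Real.exp Real.pi * Real.exp (1 / 2) * v * |t| ^ 3 *
        Real.exp (-(2 / Real.pi ^ 2 * v * t ^ 2))) :
    ‖(∫ t in (-Real.pi)..Real.pi, Complex.exp (-(y * t * Complex.I)) * f t) -
      ∫ t : ℝ, Complex.exp (-(y * t * Complex.I)) * (Real.exp (-(v * t ^ 2 / 2)) : ℂ)‖ ≤
      localLimitConst / v := by
  have hv0 : 0 < v := by linarith
  have hpi := Real.pi_pos
  have hpi3 := Real.pi_gt_three
  have hnorm : ∀ t : ℝ, ‖Complex.exp (-(y * t * Complex.I))‖ = 1 := by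
    intro t
    have : (-(y * t * Complex.I) : ℂ) = ((-(y * t) : ℝ) : ℂ) * Complex.I := by push_cast; ring
    rw [this, Complex.norm_exp_ofReal_mul_I]
  have hgi : Integrable fun t : ℝ =>
      Complex.exp (-(y * t * Complex.I)) * (Real.exp (-(v * t ^ 2 / 2)) : ℂ) := by
    refine ((integrable_exp_neg_mul_sq (half_pos hv0)).mono' (by fun_prop) ?_)
    refine ae_of_all _ fun t => le_of_eq ?_
    rw [norm_mul, hnorm, one_mul, Complex.norm_real, Real.norm_of_nonneg (Real.exp_pos _).le]
    congr 1; ring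
  have hc : Continuous fun t : ℝ => Complex.exp (-(y * t * Complex.I)) * f t := by fun_prop
  have hfi : Integrable ((Set.Ioc (-Real.pi) Real.pi).indicator fun t : ℝ =>
      Complex.exp (-(y * t * Complex.I)) * f t) := by
    rw [integrable_indicator_iff measurableSet_Ioc]
    exact (hc.integrableOn_Icc (a := -Real.pi) (b := Real.pi)).mono_set Set.Ioc_subset_Icc_self
  rw [intervalIntegral.integral_of_le (by linarith), ← integral_indicator measurableSet_Ioc,
    ← integral_sub hfi hgi]
  have hb : (0 : ℝ) < 2 / Real.pi ^ 2 := by positivity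
  have hint := integral_abs_pow_three_mul_exp (b := 2 / Real.pi ^ 2) hv0
  have hGi := (integrable_abs_pow_three_mul_exp (mul_pos hb hv0)).const_mul
    (2 * Real.exp Real.pi * Real.exp (1 / 2) * v)
  refine (norm_integral_le_of_norm_le hGi (ae_of_all _ fun t => ?_)).trans (le_of_eq ?_)
  · by_cases ht : t ∈ Set.Ioc (-Real.pi) Real.pi
    · rw [Set.indicator_of_mem ht, ← mul_sub, norm_mul, hnorm, one_mul, ← mul_assoc]
      exact hfv t (abs_le.mpr ⟨ht.1.le, ht.2⟩)
    · rw [Set.indicator_of_notMem ht, zero_sub, norm_neg, norm_mul, hnorm, one_mul,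
        Complex.norm_real, Real.norm_of_nonneg (Real.exp_pos _).le, ← mul_assoc]
      have hta : 3 ≤ |t| := by
        rw [Set.mem_Ioc, not_and_or, not_lt, not_le] at ht
        rcases ht with h | h
        · linarith [neg_le_abs t]
        · linarith [le_abs_self t]
      have h1 : Real.exp (-(v * t ^ 2 / 2)) ≤ Real.exp (-(2 / Real.pi ^ 2 * v * t ^ 2)) := by
        refine Real.exp_le_exp.mpr (neg_le_neg ?_)
        have : 2 / Real.pi ^ 2 ≤ 1 / 2 := by
          rw [div_le_div_iff₀ (by positivity) (by positivity)]
          nlinarith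
        have := mul_le_mul_of_nonneg_right this (show 0 ≤ v * t ^ 2 by positivity)
        linarith
      have h2 : (1 : ℝ) ≤ 2 * Real.exp Real.pi * Real.exp (1 / 2) * v * |t| ^ 3 := by
        have a1 : 1 ≤ Real.exp Real.pi := Real.one_le_exp hpi.le
        have a2 : 1 ≤ Real.exp (1 / 2) := Real.one_le_exp (by norm_num)
        have a3 : (3 : ℝ) ^ 3 ≤ |t| ^ 3 := by gcongr
        calc (1 : ℝ) ≤ 2 * 1 * 1 * (1 / 4) * 3 ^ 3 := by norm_num
          _ ≤ _ := by gcongr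
      exact h1.trans (le_mul_of_one_le_left (Real.exp_pos _).le h2)
  · rw [integral_const_mul, hint, localLimitConst]
    field_simp

/-- Local limit theorem, with rate, for `1` plus a sum of independent Bernoulli variables. -/
theorem abs_sqrt_mul_coeff_sub_gaussian_le {ι : Type*} (S : Finset ι) (p : ι → ℝ)
    (hp0 : ∀ i ∈ S, 0 ≤ p i) (hp1 : ∀ i ∈ S, p i ≤ 1)
    (hv : 1 / 4 ≤ ∑ i ∈ S, p i * (1 - p i)) (k : ℕ) :
    |Real.sqrt (∑ i ∈ S, p i * (1 - p i)) * (Polynomial.X *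
        ∏ i ∈ S, (Polynomial.C (1 - p i) + Polynomial.C (p i) * Polynomial.X)).coeff k -
      Real.exp (-((k - (1 + ∑ i ∈ S, p i)) / Real.sqrt (∑ i ∈ S, p i * (1 - p i))) ^ 2 / 2) /
        Real.sqrt (2 * Real.pi)| ≤
      localLimitConst / (2 * Real.pi) / Real.sqrt (∑ i ∈ S, p i * (1 - p i)) := by
  set v := ∑ i ∈ S, p i * (1 - p i) with hvdef
  set Q : Polynomial ℝ := Polynomial.X *
    ∏ i ∈ S, (Polynomial.C (1 - p i) + Polynomial.C (p i) * Polynomial.X) with hQ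
  set y : ℝ := k - (1 + ∑ i ∈ S, p i) with hy
  have hv0 : 0 < v := by linarith
  have hs := Real.sqrt_pos.mpr hv0
  have hsq := Real.sq_sqrt hv0.le
  have hpi := Real.pi_pos
  have hf : Continuous fun t : ℝ => ∏ i ∈ S, bernoulliChar (p i) t := by
    unfold bernoulliChar; fun_prop
  have h := norm_integral_sub_integral_gaussian_le (y := y) hf hv
    fun t ht => norm_prod_bernoulliChar_sub_exp_le S p hp0 hp1 ht
  have hI := Polynomial.integral_eval_exp_mul_I (Q.map Complex.ofRealHom) k
  -- Centring the Bernoulli factors and absorbing the factor `X` shifts the frequency from `k` to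
  -- `y`.
  have e : ∀ t : ℝ, (Q.map Complex.ofRealHom).eval (Complex.exp (t * Complex.I)) *
      Complex.exp (-(k * t * Complex.I)) =
      Complex.exp (-(y * t * Complex.I)) * ∏ i ∈ S, bernoulliChar (p i) t := by
    intro t
    simp only [hQ, Polynomial.map_mul, Polynomial.map_X, Polynomial.map_prod, Polynomial.map_add,
      Polynomial.map_C, Polynomial.eval_mul, Polynomial.eval_X, Polynomial.eval_prod,
      Polynomial.eval_add, Polynomial.eval_C, bernoulliChar, Finset.prod_mul_distrib,
      Complex.ofRealHom_eq_coe]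
    rw [← Complex.exp_sum]
    have : Complex.exp (-(y * t * Complex.I)) * Complex.exp (∑ i ∈ S, -(p i * t * Complex.I)) =
        Complex.exp (t * Complex.I) * Complex.exp (-(k * t * Complex.I)) := by
      rw [← Complex.exp_add, ← Complex.exp_add, Finset.sum_neg_distrib, ← Finset.sum_mul,
        ← Finset.sum_mul, hy]
      congr 1
      push_cast
      ring
    rw [← mul_assoc, this]
    ring
  simp_rw [e] at hI
  rw [hI, integral_exp_mul_gaussian hv0, Polynomial.coeff_map, Complex.ofRealHom_eq_coe] at h
  have h' : |2 * Real.pi * Q.coeff k - Real.sqrt (2 * Real.pi) / Real.sqrt v *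
      Real.exp (-(y / Real.sqrt v) ^ 2 / 2)| ≤ localLimitConst / v := by
    rw [← Real.norm_eq_abs, ← Complex.norm_real]
    simpa using h
  have h2pi : Real.sqrt (2 * Real.pi) ^ 2 = 2 * Real.pi := Real.sq_sqrt (by positivity)
  have h2s : 0 < Real.sqrt (2 * Real.pi) := Real.sqrt_pos.mpr (by positivity)
  have e2 : Real.sqrt v * Q.coeff k - Real.exp (-(y / Real.sqrt v) ^ 2 / 2) /
      Real.sqrt (2 * Real.pi) = Real.sqrt v / (2 * Real.pi) * (2 * Real.pi * Q.coeff k -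
      Real.sqrt (2 * Real.pi) / Real.sqrt v * Real.exp (-(y / Real.sqrt v) ^ 2 / 2)) := by
    generalize Real.sqrt (2 * Real.pi) = r at h2pi h2s ⊢
    rw [← h2pi]
    field_simp
  rw [e2, abs_mul, abs_of_pos (by positivity)]
  refine (mul_le_mul_of_nonneg_left h' (by positivity)).trans (le_of_eq ?_)
  nth_rewrite 2 [← hsq]
  field_simp

/-! ### Specialisation to `h_s` -/

theorem variance_term_eq (s : ℝ) {k : ℕ} (hk : 1 ≤ k) :
    1 / (1 + (k : ℝ) ^ s) * (1 - 1 / (1 + (k : ℝ) ^ s)) = (k : ℝ) ^ s / (1 + (k : ℝ) ^ s) ^ 2 := by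
  have hpos : 0 < (k : ℝ) ^ s := Real.rpow_pos_of_pos (by exact_mod_cast hk) s
  field_simp
  ring

theorem stdSigma_eq (s : ℝ) (n : ℕ) :
    stdSigma s n = Real.sqrt (∑ k ∈ Finset.Ico 1 n,
      1 / (1 + (k : ℝ) ^ s) * (1 - 1 / (1 + (k : ℝ) ^ s))) := by
  rw [stdSigma]
  congr 1
  exact Finset.sum_congr rfl fun k hk => (variance_term_eq s (Finset.mem_Ico.mp hk).1).symm

/-- The term `k = 1` equals `1/4` for every `s`, which makes the constant uniform in `s`. -/
theorem quarter_le_variance (s : ℝ) {n : ℕ} (hn : 2 ≤ n) :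
    1 / 4 ≤ ∑ k ∈ Finset.Ico 1 n, 1 / (1 + (k : ℝ) ^ s) * (1 - 1 / (1 + (k : ℝ) ^ s)) := by
  have h := Finset.single_le_sum
    (f := fun k : ℕ => 1 / (1 + (k : ℝ) ^ s) * (1 - 1 / (1 + (k : ℝ) ^ s)))
    (s := Finset.Ico 1 n) (fun k hk => by
      rw [variance_term_eq s (Finset.mem_Ico.mp hk).1]
      positivity) (Finset.mem_Ico.mpr ⟨le_rfl, hn⟩)
  refine le_trans ?_ h
  norm_num

theorem stdSigma_pos (s : ℝ) {n : ℕ} (hn : 2 ≤ n) : 0 < stdSigma s n := by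
  rw [stdSigma_eq]
  exact Real.sqrt_pos.mpr (by linarith [quarter_le_variance s hn])

theorem two_le_of_stdSigma_pos {s : ℝ} {n : ℕ} (h : 0 < stdSigma s n) : 2 ≤ n := by
  by_contra hn
  rw [stdSigma, Finset.Ico_eq_empty (by omega)] at h
  simp at h

theorem abs_stdSigma_mul_coeffA_sub_le (s : ℝ) {n : ℕ} (hn : 2 ≤ n) (k : ℕ) :
    |stdSigma s n / totalP s n * coeffA s n k
        - Real.exp (-(normX s n k) ^ 2 / 2) / Real.sqrt (2 * Real.pi)| ≤
      localLimitConst / (2 * Real.pi) / stdSigma s n := by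
  have h := abs_sqrt_mul_coeff_sub_gaussian_le (Finset.Ico 1 n)
    (fun k : ℕ => 1 / (1 + (k : ℝ) ^ s)) (fun k _ => by positivity)
    (fun k _ => by
      have : 0 ≤ (k : ℝ) ^ s := by positivity
      rw [div_le_one (by positivity)]
      linarith) (quarter_le_variance s hn) k
  rw [← stdSigma_eq] at h
  rw [coeffA_eq_totalP_mul s (by omega), ← mul_assoc,
    div_mul_cancel₀ _ (totalP_pos s (by omega)).ne']
  exact h

/-- The variance dominates a quarter of the harmonic series. -/
theorem tendsto_stdSigma_atTop {s : ℝ} (hs : |s| ≤ 1) :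
    Tendsto (fun n : ℕ => stdSigma s n) atTop atTop := by
  refine Real.tendsto_sqrt_atTop.comp ?_
  rw [← tendsto_add_atTop_iff_nat 1]
  have h := (Real.tendsto_sum_range_one_div_nat_succ_atTop).const_mul_atTop
    (show (0 : ℝ) < 1 / 4 by norm_num)
  refine tendsto_atTop_mono (fun n => ?_) h
  rw [Finset.sum_Ico_eq_sum_range, Finset.mul_sum, Nat.add_sub_cancel]
  refine Finset.sum_le_sum fun i _ => ?_
  push_cast
  rw [add_comm (1 : ℝ) i]
  set a : ℝ := (i : ℝ) + 1 with ha
  have ha1 : 1 ≤ a := by simp [ha]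
  have ha0 : 0 < a := by linarith
  have hle := abs_le.mp hs
  have h1 : a ^ s ≤ a := by
    simpa using Real.rpow_le_rpow_of_exponent_le ha1 hle.2
  have h2 : 1 ≤ a * a ^ s := by
    have : a ^ (-s) ≤ a := by
      simpa using Real.rpow_le_rpow_of_exponent_le ha1 (show -s ≤ 1 by linarith)
    have h3 : a ^ (-s) * a ^ s = 1 := by rw [← Real.rpow_add ha0]; simp
    rw [← h3]
    gcongr
  have hp : 0 < a ^ s := Real.rpow_pos_of_pos ha0 s
  rw [div_mul_div_comm, one_mul, div_le_div_iff₀ (by positivity) (by positivity)]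
  -- With `b = a^s`, each of `1`, `b` and `b²` is at most `ab`, so `(1 + b)² ≤ 4ab`.
  nlinarith [mul_le_mul_of_nonneg_right h1 hp.le, mul_le_mul_of_nonneg_right ha1 hp.le]

theorem exists_forall_abs_quotient_sub_one_lt (C : ℝ) {ε : ℝ} (hε : 0 < ε) :
    ∃ S : ℝ, 0 < S ∧ ∀ (s : ℝ) (n : ℕ), S ≤ stdSigma s n →
      ∀ k : ℕ, |(k : ℝ) - meanMu s n| ≤ C * stdSigma s n →
        |coeffA s n k / totalP s n / gaussApprox s n k - 1| < ε := by
  set K := localLimitConst / (2 * Real.pi) with hK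
  have hK0 : 0 ≤ K := div_nonneg localLimitConst_nonneg (by positivity)
  set g := Real.exp (-C ^ 2 / 2) / Real.sqrt (2 * Real.pi) with hg
  have hg0 : 0 < g := by positivity
  -- The relative error is at most `K / (σ φ)`, and `φ ≥ g` in the window; `K + 1` makes the
  -- inequality strict.
  refine ⟨(K + 1) / (g * ε), by positivity, fun s n hS k hk => ?_⟩
  have hσ : 0 < stdSigma s n := lt_of_lt_of_le (by positivity) hS
  have hn := two_le_of_stdSigma_pos hσ
  have hT := totalP_pos s (show 1 ≤ n by omega)
  have h := abs_stdSigma_mul_coeffA_sub_le s hn k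
  set φ := Real.exp (-(normX s n k) ^ 2 / 2) / Real.sqrt (2 * Real.pi) with hφ
  have hφ0 : 0 < φ := by positivity
  have hgφ : g ≤ φ := by
    have hle : |normX s n k| ≤ C := by
      rwa [normX, abs_div, abs_of_pos hσ, div_le_iff₀ hσ]
    have hsq : normX s n k ^ 2 ≤ C ^ 2 := sq_le_sq' (abs_le.mp hle).1 (abs_le.mp hle).2
    rw [hg, hφ]
    refine div_le_div_of_nonneg_right (Real.exp_le_exp.mpr ?_) (Real.sqrt_nonneg _)
    linarith
  have e : coeffA s n k / totalP s n / gaussApprox s n k - 1 =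
      (stdSigma s n / totalP s n * coeffA s n k - φ) / φ := by
    have : gaussApprox s n k = φ / stdSigma s n := by
      rw [gaussApprox, hφ, div_div, mul_comm (stdSigma s n)]
    rw [this]
    field_simp
  rw [e, abs_div, abs_of_pos hφ0, div_lt_iff₀ hφ0]
  rw [div_le_iff₀ (by positivity)] at hS
  have h2 : K / stdSigma s n < g * ε := by
    rw [div_lt_iff₀ hσ]
    linarith
  calc _ ≤ K / stdSigma s n := h
    _ < g * ε := h2
    _ ≤ ε * φ := by rw [mul_comm]; gcongr

theorem theorem3 :
    -- the bound, with one constant for all `s`, `n`, `k`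
    (∃ K : ℝ, 0 < K ∧ ∀ (s : ℝ) (n : ℕ), 2 ≤ n → ∀ k : ℕ,
      |stdSigma s n / totalP s n * coeffA s n k
          - Real.exp (-(normX s n k) ^ 2 / 2) / Real.sqrt (2 * Real.pi)| < K / stdSigma s n) ∧
    -- the asymptotic formula as `σ_n(s) → ∞`, for all real `s`
    (∀ C : ℝ, 0 < C → ∀ ε : ℝ, 0 < ε → ∃ S : ℝ, 0 < S ∧ ∀ (s : ℝ) (n : ℕ), S ≤ stdSigma s n →
      ∀ k : ℕ, |(k : ℝ) - meanMu s n| ≤ C * stdSigma s n →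
        |coeffA s n k / totalP s n / gaussApprox s n k - 1| < ε) ∧
    -- the asymptotic formula as `n → ∞`, for each fixed `s` in `[-1, 1]`
    (∀ s : ℝ, |s| ≤ 1 →
      Tendsto (fun n : ℕ => stdSigma s n) atTop atTop ∧
      ∀ C : ℝ, 0 < C → ∀ ε : ℝ, 0 < ε → ∃ N : ℕ, ∀ n : ℕ, N ≤ n →
        ∀ k : ℕ, |(k : ℝ) - meanMu s n| ≤ C * stdSigma s n →
          |coeffA s n k / totalP s n / gaussApprox s n k - 1| < ε) := by
  -- Adding `1` gives both positivity of the constant and strict inequality.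
  refine ⟨⟨localLimitConst / (2 * Real.pi) + 1, ?_, fun s n hn k => ?_⟩,
    fun C _ ε hε => exists_forall_abs_quotient_sub_one_lt C hε,
    fun s hs => ⟨tendsto_stdSigma_atTop hs, fun C _ ε hε => ?_⟩⟩
  · have := div_nonneg localLimitConst_nonneg (show 0 ≤ 2 * Real.pi by positivity)
    linarith
  · have hσ := stdSigma_pos s hn
    refine (abs_stdSigma_mul_coeffA_sub_le s hn k).trans_lt ?_
    gcongr
    linarith
  · obtain ⟨S, -, hS⟩ := exists_forall_abs_quotient_sub_one_lt C hε
    obtain ⟨N, hN⟩ := eventually_atTop.mp ((tendsto_stdSigma_atTop hs).eventually_ge_atTop S)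
    exact ⟨N, fun n hn => hS s n (hN n hn)⟩
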